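/- Let $\mathbb K=\mathbb R$ or $\mathbb C$. All manifolds are finite-dimensional and smooth (holomorphic if $\mathbb K=\mathbb C$), all maps and group actions are smooth (holomorphic), and $Fun(U)$ denotes $C^\infty(U,\mathbb R)$, respectively the holomorphic functions on $U$. A Poisson structure is a Poisson tensor (bivector field) $P$, with bracket $\{f,h\}=P(df,dh)$. Let $G$ be a Poisson Lie group with Lie algebra $\mathfrak g$, and let $D$ be a Drinfeld double of $G$ with dual group $G^*$. That is, $D$ is a connected Lie group, $G\to D$ is a homomorphism and $G^*\subset D$ is a connected Lie subgroup which induce a decomposition $Lie(D)=\mathfrak g\oplus\mathfrak g^*$ into two subalgebras, the natural inner product $\langle (x,\xi),(y,\eta)\rangle=\xi(y)+\eta(x)$ is invariant, $D$ carries the Sklyanin bracket $\{F,K\}=c\,\bigl(\langle DF,R(DK)\rangle-\langle D'F,R(D'K)\rangle\bigr)$ of $R=P_{\mathfrak g}-P_{\mathfrak g^*}$, with some normalization constant $c\neq0$, and $G\to D$ and $G^*\to D$ are Poisson maps. (Here $DF,D'F\in Lie(D)^*\cong Lie(D)$ are defined by $\frac{d}{dt}\big|_{t=0}F(e^{tX}ge^{tY})=\langle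 D_gF,X\rangle+\langle D'_gF,Y\rangle$.) Let $(M,P_M)$ and $(N,P_N)$ be Poisson manifolds with actions of $D$ such that the action maps $D\times M\to M$ and $D\times N\to N$ are Poisson maps. Let $J:M\to G^*$ be a momentum map for the action of $G$ on $M$: for every $X\in\mathfrak g$, $P_M(\,\cdot\,,J^*\tilde X)=X_M$, where $X_M(m)=\frac{d}{dt}\big|_{t=0}e^{tX}\cdot m$ and $\tilde X$ is the right-invariant one-form on $G^*$ defined by $X\in\mathfrak g=(\mathfrak g^*)^*$. Assume that $J$ is a Poisson map. For a function $F$ on a $D$-space, define $D_xF\in\mathfrak g^*$ and $\nabla_xF\in\mathfrak g$ by $$\tfrac{d}{dt}\big|_{t=0}F(e^{tX}\cdot x)=\langle D_xF,X\rangle\ \ (X\in\mathfrak g),\qquad \tfrac{d}{dt}\big|_{t=0}F(e^{t\xi}\cdot x)=\langle \xi,\nabla_xF\rangle\ \ (\xi\in\mathfrak g^*).$$ Then the map $\Sigma:M\times N\to M\times N$, $\Sigma(m,n)=(m,J(m)n)$, is a diffeomorphism (biholomorphism), and the direct sum Poisson structure on $M\times N$, transported by $\Sigma$, is a Poisson structure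 $\{\,,\}$ on $M\times N$ (the semidirect Poisson structure). For all open $U\subset M$, $V\subset N$ (in particular $U=M$, $V=N$), all $f,h\in Fun(U)$ and $\varphi,\psi\in Fun(V)$, the functions $F(m,n)=f(m)+\varphi(n)$ and $H(m,n)=h(m)+\psi(n)$ satisfy, for all $(m,n)\in U\times V$, $$\{F,H\}(m,n)=\{f,h\}_M(m)+\{\varphi,\psi\}_N(n)+\langle D_mf,\nabla_n\psi\rangle-\langle D_mh,\nabla_n\varphi\rangle .$$ -/

import Mathlib

open scoped Manifold ContDiff

namespace PoissonGeometry

noncomputable section Bivectors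

variable {𝕜 : Type*} [RCLike 𝕜]
  {E : Type*} [NormedAddCommGroup E] [NormedSpace 𝕜 E]
  {H : Type*} [TopologicalSpace H] {I : ModelWithCorners 𝕜 E H}
  {M : Type*} [TopologicalSpace M] [ChartedSpace H M]
  {E' : Type*} [NormedAddCommGroup E'] [NormedSpace 𝕜 E']
  {H' : Type*} [TopologicalSpace H'] {I' : ModelWithCorners 𝕜 E' H'}
  {M' : Type*} [TopologicalSpace M'] [ChartedSpace H' M']

instance instFiniteDimensionalTangentSpace [FiniteDimensional 𝕜 E] (x : M) :
    FiniteDimensional 𝕜 (TangentSpace I x) :=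
  inferInstanceAs (FiniteDimensional 𝕜 E)

variable (I) in
/-- The cotangent space of a (finite-dimensional) manifold at a point. -/
abbrev Cotangent (x : M) : Type _ := Module.Dual 𝕜 (TangentSpace I x)

variable (I) in
/-- The differential of a scalar function at `x`, as a covector. -/
def dAt (f : M → 𝕜) (x : M) : Cotangent I x :=
  ContinuousLinearMap.toLinearMap (mfderiv I 𝓘(𝕜, 𝕜) f x : E →L[𝕜] 𝕜)

variable (I I') in
/-- Pull-back of covectors by the derivative of `φ` at `x`. -/
def pullAt (φ : M → M') (x : M) : Cotangent I' (φ x) →ₗ[𝕜] Cotangent I x :=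
  Module.Dual.transpose (mfderiv I I' φ x).toLinearMap

variable (I M) in
/-- A (not necessarily smooth) bivector field: an alternating bilinear form on every cotangent
space. -/
structure Bivector where
  /-- the form on the cotangent space at a point -/
  form : ∀ x : M, Cotangent I x →ₗ[𝕜] Cotangent I x →ₗ[𝕜] 𝕜
  alt : ∀ (x : M) (α : Cotangent I x), form x α α = 0

namespace Bivector

/-- The bracket `{f, h} = π(df, dh)`. -/
def bracket (π : Bivector I M) (f h : M → 𝕜) (x : M) : 𝕜 :=
  π.form x (dAt I f x) (dAt I h x)

/-- `π` is a Poisson tensor: on every open set `U`, the bracket is an operation on `Fun(U)`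
(smooth functions if `𝕜 = ℝ`; holomorphic functions if `𝕜 = ℂ`, where `C^∞` over `ℂ` means
holomorphic), and it satisfies the Jacobi identity. (Bilinearity, skew-symmetry and the Leibniz
rule hold for every bivector field.) -/
structure IsPoisson (π : Bivector I M) : Prop where
  smooth : ∀ U : Set M, IsOpen U → ∀ f h : M → 𝕜,
    ContMDiffOn I 𝓘(𝕜, 𝕜) ∞ f U → ContMDiffOn I 𝓘(𝕜, 𝕜) ∞ h U →
    ContMDiffOn I 𝓘(𝕜, 𝕜) ∞ (π.bracket f h) U
  jacobi : ∀ U : Set M, IsOpen U → ∀ f g h : M → 𝕜,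
    ContMDiffOn I 𝓘(𝕜, 𝕜) ∞ f U → ContMDiffOn I 𝓘(𝕜, 𝕜) ∞ g U →
    ContMDiffOn I 𝓘(𝕜, 𝕜) ∞ h U → ∀ x ∈ U,
    π.bracket f (π.bracket g h) x + π.bracket g (π.bracket h f) x
      + π.bracket h (π.bracket f g) x = 0

/-- A smooth map `φ` is a Poisson map if it carries the bivector `π` to `π'`, equivalently if
`{f ∘ φ, h ∘ φ} = {f, h} ∘ φ` for all (locally defined) functions. -/
structure IsPoissonMap (π : Bivector I M) (π' : Bivector I' M') (φ : M → M') : Prop where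
  contMDiff : ContMDiff I I' ∞ φ
  form_eq : ∀ (x : M) (α β : Cotangent I' (φ x)),
    π'.form (φ x) α β = π.form x (pullAt I I' φ x α) (pullAt I I' φ x β)

/-- Restriction of a covector on a product to the first factor. -/
def restrFst (p : M × M') : Cotangent (I.prod I') p →ₗ[𝕜] Cotangent I p.1 :=
  Module.Dual.transpose (LinearMap.inl 𝕜 E E')

/-- Restriction of a covector on a product to the second factor. -/
def restrSnd (p : M × M') : Cotangent (I.prod I') p →ₗ[𝕜] Cotangent I' p.2 :=
  Module.Dual.transpose (LinearMap.inr 𝕜 E E')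

/-- The direct sum (product) bivector field on `M × M'`. -/
def prod (π : Bivector I M) (π' : Bivector I' M') : Bivector (I.prod I') (M × M') where
  form p := (π.form p.1).compl₁₂ (restrFst p) (restrFst p)
    + (π'.form p.2).compl₁₂ (restrSnd p) (restrSnd p)
  alt p α := by simp [π.alt, π'.alt]

/-- The push-forward of a bivector field by a diffeomorphism `e`. -/
def pushforward (π : Bivector I M) (e : M ≃ M') : Bivector I' M' where
  form y := (π.form (e.symm y)).compl₁₂
    (Module.Dual.transpose (mfderiv I I' e (e.symm y) : E →L[𝕜] E').toLinearMap)
    (Module.Dual.transpose (mfderiv I I' e (e.symm y) : E →L[𝕜] E').toLinearMap)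
  alt _ _ := π.alt _ _

end Bivector

end Bivectors

noncomputable section Double

/-- The natural inner product `⟨(x, ξ), (y, η)⟩ = ξ(y) + η(x)` on `V ⊕ V*`. -/
def doublePairing {𝕜 V : Type*} [Field 𝕜] [AddCommGroup V] [Module 𝕜 V]
    (a b : V × Module.Dual 𝕜 V) : 𝕜 :=
  a.2 b.1 + b.2 a.1

/-- The identification of the dual of `V ⊕ V*` with `V ⊕ V*` by the natural inner product. -/
def doubleSharp {𝕜 V : Type*} [Field 𝕜] [AddCommGroup V] [Module 𝕜 V] [FiniteDimensional 𝕜 V]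
    (μ : Module.Dual 𝕜 (V × Module.Dual 𝕜 V)) : V × Module.Dual 𝕜 V :=
  ((Module.evalEquiv 𝕜 V).symm (μ ∘ₗ LinearMap.inr 𝕜 V (Module.Dual 𝕜 V)),
    μ ∘ₗ LinearMap.inl 𝕜 V (Module.Dual 𝕜 V))

theorem doublePairing_doubleSharp {𝕜 V : Type*} [Field 𝕜] [AddCommGroup V] [Module 𝕜 V]
    [FiniteDimensional 𝕜 V] (μ : Module.Dual 𝕜 (V × Module.Dual 𝕜 V))
    (a : V × Module.Dual 𝕜 V) : doublePairing (doubleSharp μ) a = μ a := by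
  have h : a = LinearMap.inl 𝕜 V (Module.Dual 𝕜 V) a.1
      + LinearMap.inr 𝕜 V (Module.Dual 𝕜 V) a.2 := by ext <;> simp
  conv_rhs => rw [h, map_add]
  simp [doublePairing, doubleSharp]

/-- The bilinear form `(λ, μ) ↦ ⟨λ, R μ⟩` on the dual of `V ⊕ V*`, where `R = P_V - P_{V*}`, and
where `μ` is regarded as an element of `V ⊕ V*` by means of the natural inner product. -/
def doubleR (𝕜 V : Type*) [Field 𝕜] [AddCommGroup V] [Module 𝕜 V] [FiniteDimensional 𝕜 V] :
    Module.Dual 𝕜 (V × Module.Dual 𝕜 V) →ₗ[𝕜] Module.Dual 𝕜 (V × Module.Dual 𝕜 V) →ₗ[𝕜] 𝕜 :=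
  LinearMap.mk₂ 𝕜 (fun l μ => l ((doubleSharp μ).1, -(doubleSharp μ).2))
    (fun _ _ _ => rfl) (fun _ _ _ => rfl)
    (fun l μ ν => by
      rw [← map_add]
      congr 1
      ext <;> simp [doubleSharp, LinearMap.add_comp]
      abel)
    (fun r l μ => by
      rw [← map_smul]
      congr 1
      ext <;> simp [doubleSharp, LinearMap.smul_comp])

theorem doubleR_self {𝕜 V : Type*} [Field 𝕜] [AddCommGroup V] [Module 𝕜 V]
    [FiniteDimensional 𝕜 V] (l : Module.Dual 𝕜 (V × Module.Dual 𝕜 V)) : doubleR 𝕜 V l l = 0 := by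
  have h := doublePairing_doubleSharp l ((doubleSharp l).1, -(doubleSharp l).2)
  change l ((doubleSharp l).1, -(doubleSharp l).2) = 0
  rw [← h]
  simp [doublePairing]

variable {𝕜 : Type*} [RCLike 𝕜]
  {EG : Type*} [NormedAddCommGroup EG] [NormedSpace 𝕜 EG]
  {HG : Type*} [TopologicalSpace HG] {IG : ModelWithCorners 𝕜 EG HG}
  {G : Type*} [TopologicalSpace G] [ChartedSpace HG G] [Group G]
  {ES : Type*} [NormedAddCommGroup ES] [NormedSpace 𝕜 ES]
  {HS : Type*} [TopologicalSpace HS] {IS : ModelWithCorners 𝕜 ES HS}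
  {S : Type*} [TopologicalSpace S] [ChartedSpace HS S] [Group S]
  {ED : Type*} [NormedAddCommGroup ED] [NormedSpace 𝕜 ED]
  {HD : Type*} [TopologicalSpace HD] {ID : ModelWithCorners 𝕜 ED HD}
  {D : Type*} [TopologicalSpace D] [ChartedSpace HD D] [Group D]
  {EM : Type*} [NormedAddCommGroup EM] [NormedSpace 𝕜 EM]
  {HM : Type*} [TopologicalSpace HM] {IM : ModelWithCorners 𝕜 EM HM}
  {M : Type*} [TopologicalSpace M] [ChartedSpace HM M]
  {EN : Type*} [NormedAddCommGroup EN] [NormedSpace 𝕜 EN]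
  {HN : Type*} [TopologicalSpace HN] {IN : ModelWithCorners 𝕜 EN HN}
  {N : Type*} [TopologicalSpace N] [ChartedSpace HN N]

/-- A Poisson Lie group: a Poisson structure for which multiplication is a Poisson map. -/
structure IsPoissonLie (π : Bivector IG G) : Prop where
  isPoisson : π.IsPoisson
  mul : (π.prod π).IsPoissonMap π (fun p : G × G => p.1 * p.2)

variable (IG G IS S ID D) in
/-- `D` is a Drinfeld double group of `G` with dual group `S = G*`: homomorphisms `G → D` and
`G* ↪ D` inducing a vector space decomposition `Lie(D) = 𝔤 ⊕ 𝔤*`, for which the natural inner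
product is invariant. As `𝔤` and `𝔤*` are the images of the derivatives of homomorphisms, they
are Lie subalgebras of `Lie(D)`, isomorphic to `Lie(G)` and `Lie(G*)`. -/
structure DrinfeldDouble where
  /-- the homomorphism `G → D` -/
  incl : G →* D
  contMDiff_incl : ContMDiff IG ID ∞ incl
  /-- the inclusion of the dual group `G*` into `D` -/
  dualIncl : S →* D
  contMDiff_dualIncl : ContMDiff IS ID ∞ dualIncl
  dualIncl_injective : Function.Injective dualIncl
  /-- `Lie(D) ≅ 𝔤 ⊕ 𝔤*` -/
  lieEquiv : GroupLieAlgebra ID D ≃ₗ[𝕜]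
    (GroupLieAlgebra IG G × Module.Dual 𝕜 (GroupLieAlgebra IG G))
  /-- `Lie(G*) ≅ 𝔤*` -/
  dualEquiv : GroupLieAlgebra IS S ≃ₗ[𝕜] Module.Dual 𝕜 (GroupLieAlgebra IG G)
  lieEquiv_incl : ∀ X : GroupLieAlgebra IG G,
    lieEquiv (mfderiv IG ID incl (1 : G) X : ED) = (X, 0)
  lieEquiv_dualIncl : ∀ ξ : GroupLieAlgebra IS S,
    lieEquiv (mfderiv IS ID dualIncl (1 : S) ξ : ED) = (0, dualEquiv ξ)
  invariant : ∀ X Y Z : GroupLieAlgebra ID D,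
    doublePairing (lieEquiv ⁅X, Y⁆) (lieEquiv Z) = doublePairing (lieEquiv X) (lieEquiv ⁅Y, Z⁆)

namespace DrinfeldDouble

/-- The derivative at the identity of `k ↦ k g`, as a map `𝔤 ⊕ 𝔤* ≅ Lie(D) → T_g D`: it sends `X`
to the velocity at `t = 0` of `exp(tX) g`. -/
def rightTranslate (Δ : DrinfeldDouble IG G IS S ID D) (g : D) :
    (GroupLieAlgebra IG G × Module.Dual 𝕜 (GroupLieAlgebra IG G)) →ₗ[𝕜] TangentSpace ID g :=
  (mfderiv ID ID (fun k : D => k * g) (1 : D) : ED →L[𝕜] ED).toLinearMap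
    ∘ₗ Δ.lieEquiv.symm.toLinearMap

/-- The derivative at the identity of `k ↦ g k`, as a map `𝔤 ⊕ 𝔤* ≅ Lie(D) → T_g D`: it sends `X`
to the velocity at `t = 0` of `g exp(tX)`. -/
def leftTranslate (Δ : DrinfeldDouble IG G IS S ID D) (g : D) :
    (GroupLieAlgebra IG G × Module.Dual 𝕜 (GroupLieAlgebra IG G)) →ₗ[𝕜] TangentSpace ID g :=
  (mfderiv ID ID (fun k : D => g * k) (1 : D) : ED →L[𝕜] ED).toLinearMap
    ∘ₗ Δ.lieEquiv.symm.toLinearMap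

/-- `c` times the bivector field on `D` of the Sklyanin bracket
`{F, K} = ⟨DF, R(DK)⟩ - ⟨D'F, R(D'K)⟩` of the r-matrix `R = P_𝔤 - P_{𝔤*}`. Here `D_gF` and `D'_gF`
are the left- and right-derivatives, i.e. the composites of `dF` with `X ↦ d/dt (exp(tX) g)` and
`X ↦ d/dt (g exp(tX))`. -/
def sklyanin [FiniteDimensional 𝕜 EG] (Δ : DrinfeldDouble IG G IS S ID D) (c : 𝕜) :
    Bivector ID D where
  form g := c • ((doubleR 𝕜 (GroupLieAlgebra IG G)).compl₁₂
        (Module.Dual.transpose (Δ.rightTranslate g)) (Module.Dual.transpose (Δ.rightTranslate g))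
      - (doubleR 𝕜 (GroupLieAlgebra IG G)).compl₁₂
        (Module.Dual.transpose (Δ.leftTranslate g)) (Module.Dual.transpose (Δ.leftTranslate g)))
  alt g α := by simp [doubleR_self]

/-- The fundamental vector field of `X ∈ 𝔤` on a `D`-space: the velocity at `t = 0` of
`exp(tX) • x`. -/
def infAction (IM : ModelWithCorners 𝕜 EM HM) [MulAction D M]
    (Δ : DrinfeldDouble IG G IS S ID D) (X : GroupLieAlgebra IG G) (x : M) : TangentSpace IM x :=
  (mfderiv IG IM (fun g : G => Δ.incl g • x) (1 : G) X : EM)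

/-- The action-derivative `D_x F ∈ 𝔤*`: `⟨D_x F, X⟩ = d/dt F(exp(tX) • x)` at `t = 0`, i.e. the
derivative at the identity of `g ↦ F(g • x)` in the direction `X ∈ 𝔤`. -/
def actD [MulAction D M] (Δ : DrinfeldDouble IG G IS S ID D) (F : M → 𝕜) (x : M) :
    Module.Dual 𝕜 (GroupLieAlgebra IG G) :=
  dAt IG (fun g : G => F (Δ.incl g • x)) (1 : G)

/-- The action-derivative `∇_x F ∈ 𝔤`: `⟨ξ, ∇_x F⟩ = d/dt F(exp(tξ) • x)` at `t = 0`, i.e. the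
derivative at the identity of `p ↦ F(p • x)`, `p ∈ G*`, in the direction `ξ ∈ 𝔤*`. -/
def actNabla [FiniteDimensional 𝕜 EG] [MulAction D M] (Δ : DrinfeldDouble IG G IS S ID D)
    (F : M → 𝕜) (x : M) : GroupLieAlgebra IG G :=
  (Module.evalEquiv 𝕜 (GroupLieAlgebra IG G)).symm
    (dAt IS (fun p : S => F (Δ.dualIncl p • x)) (1 : S) ∘ₗ Δ.dualEquiv.symm.toLinearMap)

/-- The right-invariant one-form on `G*` defined by `X ∈ 𝔤`: a tangent vector `v` at `p` is moved
to the identity by right translation, which gives the `ξ ∈ 𝔤*` such that `v` is the velocity at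
`t = 0` of `exp(tξ) p`, and `ξ` is evaluated at `X`. -/
def rightInvForm (Δ : DrinfeldDouble IG G IS S ID D) (X : GroupLieAlgebra IG G) (p : S) :
    Cotangent IS p :=
  (Module.Dual.eval 𝕜 (GroupLieAlgebra IG G) X ∘ₗ Δ.dualEquiv.toLinearMap)
    ∘ₗ (mfderiv IS IS (fun q : S => q * p⁻¹) p : ES →L[𝕜] ES).toLinearMap

/-- `J : M → G*` is a momentum map for the action of `G` on `M`:
`π(·, J^*(rightInvForm X)) = X_M` for all `X ∈ 𝔤`. -/
structure IsMomentumMap [MulAction D M] (Δ : DrinfeldDouble IG G IS S ID D)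
    (π : Bivector IM M) (J : M → S) : Prop where
  contMDiff : ContMDiff IM IS ∞ J
  momentum : ∀ (X : GroupLieAlgebra IG G) (x : M) (α : Cotangent IM x),
    π.form x α (pullAt IM IS J x (Δ.rightInvForm X (J x))) = α (Δ.infAction IM X x)

/-- The invertible map `(m, n) ↦ (m, J(m) n)` of `M × N`. -/
def semidirectEquiv [MulAction D N] (Δ : DrinfeldDouble IG G IS S ID D) (J : M → S) :
    M × N ≃ M × N where
  toFun p := (p.1, Δ.dualIncl (J p.1) • p.2)
  invFun p := (p.1, (Δ.dualIncl (J p.1))⁻¹ • p.2)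
  left_inv p := by simp
  right_inv p := by simp

/-- The semidirect bivector field on `M × N`: the direct sum of `πM` and `πN`, transported by
`(m, n) ↦ (m, J(m) n)`. -/
def semidirect [MulAction D N] (Δ : DrinfeldDouble IG G IS S ID D) (J : M → S)
    (πM : Bivector IM M) (πN : Bivector IN N) : Bivector (IM.prod IN) (M × N) :=
  (πM.prod πN).pushforward (Δ.semidirectEquiv J)

end DrinfeldDouble

/-- The action of `D` (with bivector `πD`) on `(M, πM)` is a Poisson action: the action map
`D × M → M` is a Poisson map. -/
def IsPoissonAction [MulAction D M] (πD : Bivector ID D) (πM : Bivector IM M) : Prop :=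
  (πD.prod πM).IsPoissonMap πM (fun p : D × M => p.1 • p.2)

end Double

end PoissonGeometry

/-!
The manifold part of the claim is soft: `Σ` and its inverse are built from `J`, the homomorphism
`G* → D` and the action of `D` on `N`, hence smooth, and a push-forward by a diffeomorphism
preserves the Poisson condition (`Bivector.IsPoisson.pushforward`).

That a direct sum of Poisson tensors is Poisson (`Bivector.IsPoisson.prod`) has to be known for all
functions on the product, not only for sums of functions on the factors. The Poisson condition is
local and invariant under diffeomorphisms between open sets (`Bivector.IsLocalPoissonEquiv`), so
charts reduce it to open subsets of vector spaces. There the Jacobiator is a tensor: the second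
derivatives of the three functions cancel, and what is left is the Schouten square, which involves
only the first derivatives of the coefficients of the bivector (`HasVanishingSchouten.jacobi`,
`HasVanishingSchouten.of_jacobi`). The Schouten square of a direct sum is the sum of the Schouten
squares of the factors (`HasVanishingSchouten.prod`).

For the bracket, let `n = J(m) n₀`, so that `{F, H}(m, n)` is the direct sum bracket of `F ∘ Σ` and
`H ∘ Σ` at `(m, n₀)`. Along `M` these functions are `f + φ_J` and `h + ψ_J` with
`φ_J(m') = φ(J(m') n₀)`, along `N` they are, up to constants, `φ(J(m) ·)` and `ψ(J(m) ·)`. The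
differential of `φ_J` at `m` is the pull-back by `J` of the right-invariant one-form defined by
`∇_n φ` (`DrinfeldDouble.rightInvForm_actNabla`), so the momentum map condition turns `{f, ψ_J}`
into `⟨D_m f, ∇_n ψ⟩` (`DrinfeldDouble.bracket_momentum`). As `M → G* → D` are Poisson maps,
`{φ_J, ψ_J}` is the bracket on `D` of `k ↦ φ(k n₀)` and `k ↦ ψ(k n₀)` at `J(m)`; together with the
contribution of `N` it gives `{φ, ψ}_N(n)`, because the action on `N` is Poisson
(`IsPoissonAction.bracket_smul`).
-/

namespace PoissonGeometry

open Filter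
open scoped Topology

noncomputable section LocalTheory

variable {𝕜 : Type*} [RCLike 𝕜]
  {E : Type*} [NormedAddCommGroup E] [NormedSpace 𝕜 E]
  {H : Type*} [TopologicalSpace H] {I : ModelWithCorners 𝕜 E H}
  {M : Type*} [TopologicalSpace M] [ChartedSpace H M]
  {E' : Type*} [NormedAddCommGroup E'] [NormedSpace 𝕜 E']
  {H' : Type*} [TopologicalSpace H'] {I' : ModelWithCorners 𝕜 E' H'}
  {M' : Type*} [TopologicalSpace M'] [ChartedSpace H' M']

/-! ### Differentials and brackets -/

theorem dAt_congr {f g : M → 𝕜} {x : M} (h : f =ᶠ[𝓝 x] g) : dAt I f x = dAt I g x := by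
  unfold dAt
  rw [h.mfderiv_eq]

theorem dAt_comp {f : M' → 𝕜} {φ : M → M'} {x : M} {y : M'} (hy : φ x = y)
    (hf : MDifferentiableAt I' 𝓘(𝕜, 𝕜) f y) (hφ : MDifferentiableAt I I' φ x) :
    dAt I (fun z => f (φ z)) x
      = (dAt I' f y : E' →ₗ[𝕜] 𝕜) ∘ₗ (mfderiv I I' φ x : E →L[𝕜] E').toLinearMap := by
  subst hy
  unfold dAt
  change ContinuousLinearMap.toLinearMap (mfderiv I 𝓘(𝕜, 𝕜) (f ∘ φ) x : E →L[𝕜] 𝕜) = _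
  rw [mfderiv_comp x hf hφ]
  rfl

theorem dAt_add {f g : M → 𝕜} {x : M} (hf : MDifferentiableAt I 𝓘(𝕜, 𝕜) f x)
    (hg : MDifferentiableAt I 𝓘(𝕜, 𝕜) g x) :
    dAt I (fun z => f z + g z) x = dAt I f x + dAt I g x := by
  unfold dAt
  change ContinuousLinearMap.toLinearMap (mfderiv I 𝓘(𝕜, 𝕜) (f + g) x : E →L[𝕜] 𝕜) = _
  rw [mfderiv_add hf hg]
  rfl

theorem dAt_add_const {f : M → 𝕜} {x : M} (hf : MDifferentiableAt I 𝓘(𝕜, 𝕜) f x) (a : 𝕜) :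
    dAt I (fun z => f z + a) x = dAt I f x := by
  rw [dAt_add hf mdifferentiableAt_const]
  unfold dAt
  rw [mfderiv_const]
  exact add_zero _

theorem dAt_const_add {f : M → 𝕜} {x : M} (hf : MDifferentiableAt I 𝓘(𝕜, 𝕜) f x) (a : 𝕜) :
    dAt I (fun z => a + f z) x = dAt I f x := by
  simp_rw [add_comm a]
  exact dAt_add_const hf a

theorem restrFst_dAt {F : M × M' → 𝕜} {p : M × M'}
    (hF : MDifferentiableAt (I.prod I') 𝓘(𝕜, 𝕜) F p) :
    Bivector.restrFst p (dAt (I.prod I') F p) = dAt I (fun x => F (x, p.2)) p.1 := by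
  have h := dAt_comp (I := I) (I' := I.prod I') (φ := fun x : M => (x, p.2)) (x := p.1) (y := p)
    rfl hF (mdifferentiableAt_id.prodMk mdifferentiableAt_const)
  rw [h, mfderiv_prod_left]
  rfl

theorem restrSnd_dAt {F : M × M' → 𝕜} {p : M × M'}
    (hF : MDifferentiableAt (I.prod I') 𝓘(𝕜, 𝕜) F p) :
    Bivector.restrSnd p (dAt (I.prod I') F p) = dAt I' (fun y => F (p.1, y)) p.2 := by
  have h := dAt_comp (I := I') (I' := I.prod I') (φ := fun y : M' => (p.1, y)) (x := p.2) (y := p)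
    rfl hF (mdifferentiableAt_const.prodMk mdifferentiableAt_id)
  rw [h, mfderiv_prod_right]
  rfl

namespace Bivector

theorem bracket_congr (π : Bivector I M) {f f' g g' : M → 𝕜} {x : M} (hf : f =ᶠ[𝓝 x] f')
    (hg : g =ᶠ[𝓝 x] g') : π.bracket f g x = π.bracket f' g' x := by
  simp only [bracket, dAt_congr hf, dAt_congr hg]

theorem form_swap (π : Bivector I M) (x : M) (α β : Cotangent I x) :
    π.form x α β = -π.form x β α := by
  have h := π.alt x (α + β)
  simp only [map_add, LinearMap.add_apply, π.alt, zero_add, add_zero] at h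
  exact eq_neg_of_add_eq_zero_right h

/-- On a product, the bracket is computed along the two factors separately. -/
theorem prod_bracket (π : Bivector I M) (π' : Bivector I' M') {F K : M × M' → 𝕜} {p : M × M'}
    (hF : MDifferentiableAt (I.prod I') 𝓘(𝕜, 𝕜) F p)
    (hK : MDifferentiableAt (I.prod I') 𝓘(𝕜, 𝕜) K p) :
    (π.prod π').bracket F K p
      = π.bracket (fun x => F (x, p.2)) (fun x => K (x, p.2)) p.1
        + π'.bracket (fun y => F (p.1, y)) (fun y => K (p.1, y)) p.2 := by
  simp only [bracket, ← restrFst_dAt hF, ← restrSnd_dAt hF, ← restrFst_dAt hK, ← restrSnd_dAt hK]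
  rfl

/-- The push-forward of a bivector field along `φ`, where `ψ` chooses for every `y` the point from
which the bivector is pushed forward. It is meaningful at the points `y` with `φ (ψ y) = y`; this
covers diffeomorphisms between open sets, such as charts. -/
def pushAlong (π : Bivector I M) (φ : M → M') (ψ : M' → M) : Bivector I' M' where
  form y := (π.form (ψ y)).compl₁₂
    (Module.Dual.transpose (mfderiv I I' φ (ψ y) : E →L[𝕜] E').toLinearMap)
    (Module.Dual.transpose (mfderiv I I' φ (ψ y) : E →L[𝕜] E').toLinearMap)
  alt _ _ := π.alt _ _

theorem pushAlong_bracket (π : Bivector I M) {φ : M → M'} {ψ : M' → M} {y : M'} (hy : φ (ψ y) = y)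
    (hφ : MDifferentiableAt I I' φ (ψ y)) {f g : M' → 𝕜}
    (hf : MDifferentiableAt I' 𝓘(𝕜, 𝕜) f y) (hg : MDifferentiableAt I' 𝓘(𝕜, 𝕜) g y) :
    (π.pushAlong (I' := I') φ ψ).bracket f g y
      = π.bracket (fun x => f (φ x)) (fun x => g (φ x)) (ψ y) := by
  simp only [bracket, dAt_comp hy hf hφ, dAt_comp hy hg hφ]
  rfl

/-! ### Locality of the Poisson condition -/

/-- `π` is a Poisson tensor on the open set `W`. -/
structure IsPoissonOn (π : Bivector I M) (W : Set M) : Prop where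
  smooth : ∀ U : Set M, IsOpen U → U ⊆ W → ∀ f h : M → 𝕜,
    ContMDiffOn I 𝓘(𝕜, 𝕜) ∞ f U → ContMDiffOn I 𝓘(𝕜, 𝕜) ∞ h U →
    ContMDiffOn I 𝓘(𝕜, 𝕜) ∞ (π.bracket f h) U
  jacobi : ∀ U : Set M, IsOpen U → U ⊆ W → ∀ f g h : M → 𝕜,
    ContMDiffOn I 𝓘(𝕜, 𝕜) ∞ f U → ContMDiffOn I 𝓘(𝕜, 𝕜) ∞ g U →
    ContMDiffOn I 𝓘(𝕜, 𝕜) ∞ h U → ∀ x ∈ U,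
    π.bracket f (π.bracket g h) x + π.bracket g (π.bracket h f) x
      + π.bracket h (π.bracket f g) x = 0

theorem IsPoisson.isPoissonOn {π : Bivector I M} (hπ : π.IsPoisson) (W : Set M) :
    π.IsPoissonOn W :=
  ⟨fun U hU _ => hπ.smooth U hU, fun U hU _ => hπ.jacobi U hU⟩

theorem IsPoisson.of_local {π : Bivector I M}
    (hπ : ∀ x : M, ∃ W : Set M, IsOpen W ∧ x ∈ W ∧ π.IsPoissonOn W) : π.IsPoisson where
  smooth U hU f h hf hh x hx := by
    obtain ⟨W, hW, hxW, hP⟩ := hπ x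
    have hs := hP.smooth (U ∩ W) (hU.inter hW) Set.inter_subset_right f h
      (hf.mono Set.inter_subset_left) (hh.mono Set.inter_subset_left)
    exact (hs.contMDiffAt ((hU.inter hW).mem_nhds ⟨hx, hxW⟩)).contMDiffWithinAt
  jacobi U hU f g h hf hg hh x hx := by
    obtain ⟨W, hW, hxW, hP⟩ := hπ x
    exact hP.jacobi (U ∩ W) (hU.inter hW) Set.inter_subset_right f g h
      (hf.mono Set.inter_subset_left) (hg.mono Set.inter_subset_left)
      (hh.mono Set.inter_subset_left) x ⟨hx, hxW⟩

theorem mdifferentiableAt_of_contMDiffOn {f : M → M'} {U : Set M} (hU : IsOpen U)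
    (hf : ContMDiffOn I I' ∞ f U) {x : M} (hx : x ∈ U) : MDifferentiableAt I I' f x :=
  (hf.contMDiffAt (hU.mem_nhds hx)).mdifferentiableAt (by simp)

/-- A diffeomorphism `Φ` between open sets carries `π` to `π'`, expressed by brackets of
functions. -/
structure IsLocalPoissonEquiv (π : Bivector I M) (π' : Bivector I' M')
    (Φ : OpenPartialHomeomorph M M') : Prop where
  contMDiffOn : ContMDiffOn I I' ∞ Φ Φ.source
  contMDiffOn_symm : ContMDiffOn I' I ∞ Φ.symm Φ.target
  bracket_eq : ∀ x ∈ Φ.source, ∀ f h : M' → 𝕜,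
    MDifferentiableAt I' 𝓘(𝕜, 𝕜) f (Φ x) → MDifferentiableAt I' 𝓘(𝕜, 𝕜) h (Φ x) →
    π'.bracket f h (Φ x) = π.bracket (fun z => f (Φ z)) (fun z => h (Φ z)) x

namespace IsLocalPoissonEquiv

variable {π : Bivector I M} {π' : Bivector I' M'} {Φ : OpenPartialHomeomorph M M'}

theorem symm (hΦ : IsLocalPoissonEquiv π π' Φ) : IsLocalPoissonEquiv π' π Φ.symm where
  contMDiffOn := hΦ.contMDiffOn_symm
  contMDiffOn_symm := by simpa using hΦ.contMDiffOn
  bracket_eq y hy f h hf hh := by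
    have hx : Φ.symm y ∈ Φ.source := Φ.map_target hy
    have hy' : Φ (Φ.symm y) = y := Φ.right_inv hy
    have hd := mdifferentiableAt_of_contMDiffOn Φ.open_target hΦ.contMDiffOn_symm hy
    have key := hΦ.bracket_eq _ hx (fun z => f (Φ.symm z)) (fun z => h (Φ.symm z))
      (by rw [hy']; exact hf.comp y hd) (by rw [hy']; exact hh.comp y hd)
    rw [hy'] at key
    rw [key]
    have hev : ∀ᶠ z in 𝓝 (Φ.symm y), Φ.symm (Φ z) = z := Φ.eventually_left_inverse hx
    refine π.bracket_congr ?_ ?_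
    · filter_upwards [hev] with z hz
      rw [hz]
    · filter_upwards [hev] with z hz
      rw [hz]

theorem isPoissonOn (hΦ : IsLocalPoissonEquiv π π' Φ) (hπ : π.IsPoissonOn Φ.source) :
    π'.IsPoissonOn Φ.target := by
  have hopen : ∀ U : Set M', IsOpen U → IsOpen (Φ.source ∩ Φ ⁻¹' U) := fun U hU =>
    Φ.isOpen_inter_preimage hU
  have hcomp : ∀ {U : Set M'} {f : M' → 𝕜}, ContMDiffOn I' 𝓘(𝕜, 𝕜) ∞ f U →
      ContMDiffOn I 𝓘(𝕜, 𝕜) ∞ (fun z => f (Φ z)) (Φ.source ∩ Φ ⁻¹' U) := fun {U f} hf =>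
    hf.comp (hΦ.contMDiffOn.mono Set.inter_subset_left) fun _ hz => hz.2
  have hbr : ∀ {U : Set M'}, IsOpen U → ∀ {f h : M' → 𝕜}, ContMDiffOn I' 𝓘(𝕜, 𝕜) ∞ f U →
      ContMDiffOn I' 𝓘(𝕜, 𝕜) ∞ h U → ∀ x ∈ Φ.source ∩ Φ ⁻¹' U,
      π'.bracket f h (Φ x) = π.bracket (fun z => f (Φ z)) (fun z => h (Φ z)) x :=
    fun {U} hU {f h} hf hh x hx => hΦ.bracket_eq x hx.1 f h
      (mdifferentiableAt_of_contMDiffOn hU hf hx.2) (mdifferentiableAt_of_contMDiffOn hU hh hx.2)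
  have hmaps : ∀ {U : Set M'}, U ⊆ Φ.target → ∀ y ∈ U, Φ.symm y ∈ Φ.source ∩ Φ ⁻¹' U :=
    fun {U} hUW y hy => ⟨Φ.map_target (hUW hy), by
      rw [Set.mem_preimage, Φ.right_inv (hUW hy)]; exact hy⟩
  have hsmooth : ∀ U : Set M', IsOpen U → U ⊆ Φ.target → ∀ f h : M' → 𝕜,
      ContMDiffOn I' 𝓘(𝕜, 𝕜) ∞ f U → ContMDiffOn I' 𝓘(𝕜, 𝕜) ∞ h U →
      ContMDiffOn I' 𝓘(𝕜, 𝕜) ∞ (π'.bracket f h) U := by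
    intro U hU hUW f h hf hh
    have hs := hπ.smooth _ (hopen U hU) Set.inter_subset_left _ _ (hcomp hf) (hcomp hh)
    refine (hs.comp (hΦ.contMDiffOn_symm.mono hUW) (hmaps hUW)).congr fun y hy => ?_
    have h1 := hbr hU hf hh _ (hmaps hUW y hy)
    rw [Φ.right_inv (hUW hy)] at h1
    exact h1
  refine ⟨hsmooth, ?_⟩
  intro U hU hUW f g h hf hg hh y hy
  have hx := hmaps hUW y hy
  have hnest : ∀ f g h : M' → 𝕜, ContMDiffOn I' 𝓘(𝕜, 𝕜) ∞ f U → ContMDiffOn I' 𝓘(𝕜, 𝕜) ∞ g U →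
      ContMDiffOn I' 𝓘(𝕜, 𝕜) ∞ h U → π'.bracket f (π'.bracket g h) y
        = π.bracket (fun z => f (Φ z)) (π.bracket (fun z => g (Φ z)) (fun z => h (Φ z)))
            (Φ.symm y) := by
    intro f g h hf hg hh
    have h1 := hbr hU hf (hsmooth U hU hUW g h hg hh) _ hx
    rw [Φ.right_inv (hUW hy)] at h1
    rw [h1]
    refine π.bracket_congr EventuallyEq.rfl ?_
    filter_upwards [(hopen U hU).mem_nhds hx] with z hz
    exact hbr hU hg hh z hz
  rw [hnest f g h hf hg hh, hnest g h f hg hh hf, hnest h f g hh hf hg]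
  exact hπ.jacobi _ (hopen U hU) Set.inter_subset_left _ _ _ (hcomp hf) (hcomp hg) (hcomp hh) _ hx

end IsLocalPoissonEquiv

/-- A diffeomorphism between open sets carries `π` to its push-forward. -/
theorem isLocalPoissonEquiv_pushAlong (π : Bivector I M) (Φ : OpenPartialHomeomorph M M')
    (hΦ : ContMDiffOn I I' ∞ Φ Φ.source) (hΦ' : ContMDiffOn I' I ∞ Φ.symm Φ.target) :
    IsLocalPoissonEquiv π (π.pushAlong (I' := I') Φ Φ.symm) Φ where
  contMDiffOn := hΦ
  contMDiffOn_symm := hΦ'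
  bracket_eq x hx f h hf hh := by
    have hinv : Φ.symm (Φ x) = x := Φ.left_inv hx
    have hd := mdifferentiableAt_of_contMDiffOn Φ.open_source hΦ hx
    rw [pushAlong_bracket (φ := Φ) (ψ := Φ.symm) π (by rw [hinv]) (by rw [hinv]; exact hd) hf hh,
      hinv]

/-- Push-forward by a diffeomorphism preserves the Poisson condition. -/
theorem IsPoisson.pushforward {π : Bivector I M} (hπ : π.IsPoisson) (e : M ≃ M')
    (he : ContMDiff I I' ∞ e) (he' : ContMDiff I' I ∞ e.symm) :
    (π.pushforward (I' := I') e).IsPoisson := by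
  let Φ : OpenPartialHomeomorph M M' :=
    ({ e with continuous_toFun := he.continuous, continuous_invFun := he'.continuous } :
      M ≃ₜ M').toOpenPartialHomeomorph
  have h := (isLocalPoissonEquiv_pushAlong π Φ he.contMDiffOn he'.contMDiffOn).isPoissonOn
    (hπ.isPoissonOn _)
  exact IsPoisson.of_local fun y => ⟨Set.univ, isOpen_univ, trivial, h⟩

/-- Products of Poisson diffeomorphisms between open sets. -/
theorem IsLocalPoissonEquiv.prod
    {F : Type*} [NormedAddCommGroup F] [NormedSpace 𝕜 F] {K : Type*} [TopologicalSpace K]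
    {L : ModelWithCorners 𝕜 F K} {Q : Type*} [TopologicalSpace Q] [ChartedSpace K Q]
    {F' : Type*} [NormedAddCommGroup F'] [NormedSpace 𝕜 F'] {K' : Type*} [TopologicalSpace K']
    {L' : ModelWithCorners 𝕜 F' K'} {Q' : Type*} [TopologicalSpace Q'] [ChartedSpace K' Q']
    {π : Bivector I M} {π' : Bivector I' M'} {Φ : OpenPartialHomeomorph M M'}
    {ρ : Bivector L Q} {ρ' : Bivector L' Q'} {Ψ : OpenPartialHomeomorph Q Q'}
    (hΦ : IsLocalPoissonEquiv π π' Φ) (hΨ : IsLocalPoissonEquiv ρ ρ' Ψ) :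
    IsLocalPoissonEquiv (π.prod ρ) (π'.prod ρ') (Φ.prod Ψ) where
  contMDiffOn := hΦ.contMDiffOn.prodMap hΨ.contMDiffOn
  contMDiffOn_symm := hΦ.contMDiffOn_symm.prodMap hΨ.contMDiffOn_symm
  bracket_eq := by
    rintro ⟨x, y⟩ ⟨hx, hy⟩ f h hf hh
    have hd : MDifferentiableAt (I.prod L) (I'.prod L') (Φ.prod Ψ) (x, y) :=
      mdifferentiableAt_of_contMDiffOn (Φ.prod Ψ).open_source
        (hΦ.contMDiffOn.prodMap hΨ.contMDiffOn) ⟨hx, hy⟩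
    have hl : ∀ {f : M' × Q' → 𝕜}, MDifferentiableAt (I'.prod L') 𝓘(𝕜, 𝕜) f (Φ x, Ψ y) →
        MDifferentiableAt I' 𝓘(𝕜, 𝕜) (fun z => f (z, Ψ y)) (Φ x) := fun hf =>
      hf.comp (Φ x) (mdifferentiableAt_id.prodMk mdifferentiableAt_const)
    have hr : ∀ {f : M' × Q' → 𝕜}, MDifferentiableAt (I'.prod L') 𝓘(𝕜, 𝕜) f (Φ x, Ψ y) →
        MDifferentiableAt L' 𝓘(𝕜, 𝕜) (fun z => f (Φ x, z)) (Ψ y) := fun hf =>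
      hf.comp (Ψ y) (mdifferentiableAt_const.prodMk mdifferentiableAt_id)
    refine Eq.trans ?_ (prod_bracket π ρ (hf.comp (x, y) hd) (hh.comp (x, y) hd)).symm
    refine (prod_bracket _ _ hf hh).trans ?_
    exact congrArg₂ (· + ·) (hΦ.bracket_eq x hx _ _ (hl hf) (hl hh))
      (hΨ.bracket_eq y hy _ _ (hr hf) (hr hh))

end Bivector

end LocalTheory

/-! ### The Jacobi identity in a vector space -/

noncomputable section LinearTheory

set_option maxSynthPendingDepth 3

open Module

variable {𝕜 : Type*} [RCLike 𝕜]
  {E : Type*} [NormedAddCommGroup E] [NormedSpace 𝕜 E]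
  {E' : Type*} [NormedAddCommGroup E'] [NormedSpace 𝕜 E']

/-- The differential of a function on a vector space, as a linear functional. -/
def linDiff (f : E → 𝕜) (y : E) : Dual 𝕜 E :=
  (fderiv 𝕜 f y).toLinearMap

/-- The bracket of functions on a vector space defined by a family `b` of bilinear forms on the
dual space. -/
def linBracket (b : E → Dual 𝕜 E →ₗ[𝕜] Dual 𝕜 E →ₗ[𝕜] 𝕜) (f g : E → 𝕜) (y : E) : 𝕜 :=
  b y (linDiff f y) (linDiff g y)

/-- A smooth family `b` of bilinear forms on the dual space whose Schouten square vanishes on `T`.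
The Schouten square is the cyclic sum of the `∂_{u} (b(β, γ))`, where `u` is the vector that
corresponds to `b(α, ·)`. -/
structure HasVanishingSchouten (b : E → Dual 𝕜 E →ₗ[𝕜] Dual 𝕜 E →ₗ[𝕜] 𝕜) (T : Set E) : Prop where
  smooth : ∀ α β : Dual 𝕜 E, ContDiffOn 𝕜 ∞ (fun y => b y α β) T
  schouten : ∀ y ∈ T, ∀ (α β γ : Dual 𝕜 E) (u v w : E),
    (∀ δ : Dual 𝕜 E, δ u = b y α δ) → (∀ δ : Dual 𝕜 E, δ v = b y β δ) →
    (∀ δ : Dual 𝕜 E, δ w = b y γ δ) →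
    fderiv 𝕜 (fun z => b z β γ) y u + fderiv 𝕜 (fun z => b z γ α) y v
      + fderiv 𝕜 (fun z => b z α β) y w = 0

/-- The Schouten square of a product is the sum of the Schouten squares of the factors. -/
theorem HasVanishingSchouten.prod {b : E → Dual 𝕜 E →ₗ[𝕜] Dual 𝕜 E →ₗ[𝕜] 𝕜} {T : Set E}
    {b' : E' → Dual 𝕜 E' →ₗ[𝕜] Dual 𝕜 E' →ₗ[𝕜] 𝕜} {T' : Set E'}
    (hb : HasVanishingSchouten b T) (hT : IsOpen T)
    (hb' : HasVanishingSchouten b' T') (hT' : IsOpen T') :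
    HasVanishingSchouten (fun p : E × E' =>
      (b p.1).compl₁₂ (Dual.transpose (LinearMap.inl 𝕜 E E'))
          (Dual.transpose (LinearMap.inl 𝕜 E E'))
        + (b' p.2).compl₁₂ (Dual.transpose (LinearMap.inr 𝕜 E E'))
          (Dual.transpose (LinearMap.inr 𝕜 E E'))) (T ×ˢ T') where
  smooth α β :=
    ((hb.smooth _ _).comp contDiff_fst.contDiffOn fun _ hp => hp.1).add
      ((hb'.smooth _ _).comp contDiff_snd.contDiffOn fun _ hp => hp.2)
  schouten := by
    rintro ⟨y, y'⟩ ⟨hy, hy'⟩ α β γ u v w hu hv hw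
    have hd : ∀ (β γ : Dual 𝕜 (E × E')) (u : E × E'),
        fderiv 𝕜 (fun p : E × E' => b p.1 (β ∘ₗ LinearMap.inl 𝕜 E E') (γ ∘ₗ LinearMap.inl 𝕜 E E')
          + b' p.2 (β ∘ₗ LinearMap.inr 𝕜 E E') (γ ∘ₗ LinearMap.inr 𝕜 E E')) (y, y') u
        = fderiv 𝕜 (fun z => b z (β ∘ₗ LinearMap.inl 𝕜 E E') (γ ∘ₗ LinearMap.inl 𝕜 E E')) y u.1
          + fderiv 𝕜 (fun z => b' z (β ∘ₗ LinearMap.inr 𝕜 E E') (γ ∘ₗ LinearMap.inr 𝕜 E E'))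
            y' u.2 := by
      intro β γ u
      have h1 := (((hb.smooth (β ∘ₗ LinearMap.inl 𝕜 E E') (γ ∘ₗ LinearMap.inl 𝕜 E E')).contDiffAt
        (hT.mem_nhds hy)).differentiableAt (by simp)).hasFDerivAt.comp (y, y')
          (hasFDerivAt_fst (𝕜 := 𝕜))
      have h2 := (((hb'.smooth (β ∘ₗ LinearMap.inr 𝕜 E E') (γ ∘ₗ LinearMap.inr 𝕜 E E')).contDiffAt
        (hT'.mem_nhds hy')).differentiableAt (by simp)).hasFDerivAt.comp (y, y')
          (hasFDerivAt_snd (𝕜 := 𝕜))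
      exact DFunLike.congr_fun (h1.add h2).fderiv u
    have hl : ∀ {α : Dual 𝕜 (E × E')} {u : E × E'},
        (∀ δ : Dual 𝕜 (E × E'), δ u
          = b y (α ∘ₗ LinearMap.inl 𝕜 E E') (δ ∘ₗ LinearMap.inl 𝕜 E E')
            + b' y' (α ∘ₗ LinearMap.inr 𝕜 E E') (δ ∘ₗ LinearMap.inr 𝕜 E E')) →
        ∀ δ : Dual 𝕜 E, δ u.1 = b y (α ∘ₗ LinearMap.inl 𝕜 E E') δ := by
      intro α u h δ
      have := h (δ ∘ₗ LinearMap.fst 𝕜 E E')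
      simpa [LinearMap.comp_assoc] using this
    have hr : ∀ {α : Dual 𝕜 (E × E')} {u : E × E'},
        (∀ δ : Dual 𝕜 (E × E'), δ u
          = b y (α ∘ₗ LinearMap.inl 𝕜 E E') (δ ∘ₗ LinearMap.inl 𝕜 E E')
            + b' y' (α ∘ₗ LinearMap.inr 𝕜 E E') (δ ∘ₗ LinearMap.inr 𝕜 E E')) →
        ∀ δ : Dual 𝕜 E', δ u.2 = b' y' (α ∘ₗ LinearMap.inr 𝕜 E E') δ := by
      intro α u h δ
      have := h (δ ∘ₗ LinearMap.snd 𝕜 E E')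
      simpa [LinearMap.comp_assoc] using this
    have h1 := hb.schouten y hy _ _ _ _ _ _ (hl hu) (hl hv) (hl hw)
    have h2 := hb'.schouten y' hy' _ _ _ _ _ _ (hr hu) (hr hv) (hr hw)
    refine (congrArg₂ (· + ·) (congrArg₂ (· + ·) (hd β γ u) (hd γ α v)) (hd α β w)).trans ?_
    linear_combination h1 + h2

variable [FiniteDimensional 𝕜 E]

/-- A bilinear form on the dual space as an element of the normed space of continuous bilinear maps,
where families of forms can be differentiated. -/
def toContinuousBilin (b : Dual 𝕜 E →ₗ[𝕜] Dual 𝕜 E →ₗ[𝕜] 𝕜) :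
    (E →L[𝕜] 𝕜) →L[𝕜] (E →L[𝕜] 𝕜) →L[𝕜] 𝕜 :=
  LinearMap.toContinuousLinearMap
    ((LinearMap.toContinuousLinearMap : ((E →L[𝕜] 𝕜) →ₗ[𝕜] 𝕜) ≃ₗ[𝕜] _).toLinearMap
      ∘ₗ b.compl₁₂ (ContinuousLinearMap.coeLM 𝕜) (ContinuousLinearMap.coeLM 𝕜))

theorem toContinuousBilin_apply (b : Dual 𝕜 E →ₗ[𝕜] Dual 𝕜 E →ₗ[𝕜] 𝕜) (α β : E →L[𝕜] 𝕜) :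
    toContinuousBilin b α β = b α.toLinearMap β.toLinearMap :=
  rfl

theorem linDiff_toContinuousLinearMap (α : Dual 𝕜 E) (y : E) :
    linDiff (fun z => LinearMap.toContinuousLinearMap α z) y = α := by
  unfold linDiff
  rw [ContinuousLinearMap.fderiv]
  rfl

/-- Finite-dimensional spaces are reflexive. -/
theorem exists_forall_dual_eq (l : Dual 𝕜 (Dual 𝕜 E)) : ∃ u : E, ∀ δ : Dual 𝕜 E, δ u = l δ :=
  ⟨(evalEquiv 𝕜 E).symm l, fun δ => apply_evalEquiv_symm_apply 𝕜 E δ l⟩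

namespace HasVanishingSchouten

variable {b : E → Dual 𝕜 E →ₗ[𝕜] Dual 𝕜 E →ₗ[𝕜] 𝕜} {T : Set E}

/-- If the bracket of `b` maps smooth functions to smooth functions and satisfies the Jacobi
identity, then the Schouten square vanishes: it is the Jacobiator of linear functions. -/
theorem of_jacobi
    (hs : ∀ f g : E → 𝕜, ContDiffOn 𝕜 ∞ f T → ContDiffOn 𝕜 ∞ g T →
      ContDiffOn 𝕜 ∞ (linBracket b f g) T)
    (hj : ∀ f g h : E → 𝕜, ContDiffOn 𝕜 ∞ f T → ContDiffOn 𝕜 ∞ g T → ContDiffOn 𝕜 ∞ h T →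
      ∀ y ∈ T, linBracket b f (linBracket b g h) y + linBracket b g (linBracket b h f) y
        + linBracket b h (linBracket b f g) y = 0) : HasVanishingSchouten b T := by
  have hlin : ∀ α : Dual 𝕜 E, ContDiffOn 𝕜 ∞ (fun z => LinearMap.toContinuousLinearMap α z) T :=
    fun α => (ContinuousLinearMap.contDiff _).contDiffOn
  have hbr : ∀ α β : Dual 𝕜 E, linBracket b (fun z => LinearMap.toContinuousLinearMap α z)
      (fun z => LinearMap.toContinuousLinearMap β z) = fun y => b y α β := by
    intro α β
    funext y
    simp only [linBracket, linDiff_toContinuousLinearMap]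
  refine ⟨fun α β => ?_, fun y hy α β γ u v w hu hv hw => ?_⟩
  · rw [← hbr]
    exact hs _ _ (hlin α) (hlin β)
  · have h := hj _ _ _ (hlin α) (hlin β) (hlin γ) y hy
    simp only [hbr] at h
    simp only [linBracket, linDiff_toContinuousLinearMap] at h
    rw [← hu, ← hv, ← hw] at h
    exact h

theorem contDiffOn_toContinuousBilin (hb : HasVanishingSchouten b T)
    : ContDiffOn 𝕜 ∞ (fun y => toContinuousBilin (b y)) T := by
  refine contDiffOn_clm_apply.2 fun α => contDiffOn_clm_apply.2 fun β => ?_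
  exact hb.smooth _ _

theorem contDiffOn_linBracket (hb : HasVanishingSchouten b T)
    {f g : E → 𝕜} {U : Set E} (hU : IsOpen U) (hUT : U ⊆ T)
    (hf : ContDiffOn 𝕜 ∞ f U) (hg : ContDiffOn 𝕜 ∞ g U) :
    ContDiffOn 𝕜 ∞ (linBracket b f g) U :=
  (((contDiffOn_toContinuousBilin hb).mono hUT).clm_apply
    (hf.fderiv_of_isOpen hU (by simp))).clm_apply (hg.fderiv_of_isOpen hU (by simp))

/-- The derivative of a bracket along `u`, by the product rule. -/
theorem linDiff_linBracket_apply (hT : IsOpen T) (hb : HasVanishingSchouten b T)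
    {f g : E → 𝕜} {y : E} (hy : y ∈ T)
    (hf : ContDiffAt 𝕜 ∞ f y) (hg : ContDiffAt 𝕜 ∞ g y) (u : E) :
    linDiff (linBracket b f g) y u
      = fderiv 𝕜 (fun z => b z (linDiff f y) (linDiff g y)) y u
        + b y (fderiv 𝕜 (fderiv 𝕜 f) y u).toLinearMap (linDiff g y)
        + b y (linDiff f y) (fderiv 𝕜 (fderiv 𝕜 g) y u).toLinearMap := by
  have hB := (((contDiffOn_toContinuousBilin hb).contDiffAt
    (hT.mem_nhds hy)).differentiableAt (by simp)).hasFDerivAt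
  have hf' := ((hf.fderiv_right (m := ∞) (by simp)).differentiableAt (by simp)).hasFDerivAt
  have hg' := ((hg.fderiv_right (m := ∞) (by simp)).differentiableAt (by simp)).hasFDerivAt
  have h1 := ((hB.clm_apply hf').clm_apply hg').fderiv
  have h2 := ((hB.clm_apply (hasFDerivAt_const (fderiv 𝕜 f y) y)).clm_apply
    (hasFDerivAt_const (fderiv 𝕜 g y) y)).fderiv
  have h1u := DFunLike.congr_fun h1 u
  have h2u := DFunLike.congr_fun h2 u
  simp only [add_apply, ContinuousLinearMap.comp_apply,
    ContinuousLinearMap.flip_apply, zero_add,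
    ContinuousLinearMap.comp_zero] at h1u h2u
  refine h1u.trans ?_
  refine Eq.trans ?_ (congrArg (fun t => t + b y (fderiv 𝕜 (fderiv 𝕜 f) y u).toLinearMap
    (linDiff g y) + b y (linDiff f y) (fderiv 𝕜 (fderiv 𝕜 g) y u).toLinearMap) h2u.symm)
  simp only [toContinuousBilin_apply]
  unfold linDiff
  ring

/-- If the Schouten square vanishes, the Jacobi identity holds: in the Jacobiator the second
derivatives of the three functions cancel, because they are symmetric and the bracket is skew. -/
theorem jacobi (hT : IsOpen T) (hb : HasVanishingSchouten b T)
    (halt : ∀ y α, b y α α = 0) {f g h : E → 𝕜} {y : E} (hy : y ∈ T)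
    (hf : ContDiffAt 𝕜 ∞ f y) (hg : ContDiffAt 𝕜 ∞ g y) (hh : ContDiffAt 𝕜 ∞ h y) :
    linBracket b f (linBracket b g h) y + linBracket b g (linBracket b h f) y
      + linBracket b h (linBracket b f g) y = 0 := by
  have hswap : ∀ α β, b y α β = -b y β α := fun α β => by
    have h := halt y (α + β)
    simp only [map_add, LinearMap.add_apply, halt, zero_add, add_zero] at h
    exact eq_neg_of_add_eq_zero_right h
  obtain ⟨u, hu⟩ := exists_forall_dual_eq (b y (linDiff f y))
  obtain ⟨v, hv⟩ := exists_forall_dual_eq (b y (linDiff g y))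
  obtain ⟨w, hw⟩ := exists_forall_dual_eq (b y (linDiff h y))
  have hsymm : ∀ {f : E → 𝕜}, ContDiffAt 𝕜 ∞ f y → ∀ p q,
      fderiv 𝕜 (fderiv 𝕜 f) y p q = fderiv 𝕜 (fderiv 𝕜 f) y q p := fun hf p q =>
    hf.isSymmSndFDerivAt (by
      rw [minSmoothness_of_isRCLikeNormedField]; exact WithTop.coe_le_coe.2 le_top) p q
  have hS := hb.schouten y hy _ _ _ u v w hu hv hw
  have e1 : linBracket b f (linBracket b g h) y = linDiff (linBracket b g h) y u := (hu _).symm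
  have e2 : linBracket b g (linBracket b h f) y = linDiff (linBracket b h f) y v := (hv _).symm
  have e3 : linBracket b h (linBracket b f g) y = linDiff (linBracket b f g) y w := (hw _).symm
  rw [e1, e2, e3, linDiff_linBracket_apply hT hb hy hg hh,
    linDiff_linBracket_apply hT hb hy hh hf, linDiff_linBracket_apply hT hb hy hf hg,
    hswap _ (linDiff f y), hswap _ (linDiff g y), hswap _ (linDiff h y)]
  simp only [← hu, ← hv, ← hw]
  simp only [ContinuousLinearMap.coe_coe]
  linear_combination hS - hsymm hg u w - hsymm hh v u - hsymm hf w v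

end HasVanishingSchouten

end LinearTheory

/-! ### Products of Poisson manifolds -/

noncomputable section Product

variable {𝕜 : Type*} [RCLike 𝕜]
  {E : Type*} [NormedAddCommGroup E] [NormedSpace 𝕜 E]
  {E' : Type*} [NormedAddCommGroup E'] [NormedSpace 𝕜 E']

namespace Bivector

theorem linBracket_form (π : Bivector 𝓘(𝕜, E) E) (f g : E → 𝕜) :
    linBracket (fun y => π.form y) f g = π.bracket f g := by
  funext y
  simp only [linBracket, linDiff, bracket, dAt, mfderiv_eq_fderiv]
  rfl

theorem IsPoissonOn.hasVanishingSchouten [FiniteDimensional 𝕜 E] {π : Bivector 𝓘(𝕜, E) E}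
    {T : Set E} (hT : IsOpen T) (hπ : π.IsPoissonOn T) :
    HasVanishingSchouten (fun y => π.form y) T := by
  refine HasVanishingSchouten.of_jacobi ?_ ?_
  · intro f g hf hg
    rw [linBracket_form]
    exact (hπ.smooth T hT subset_rfl f g hf.contMDiffOn hg.contMDiffOn).contDiffOn
  · intro f g h hf hg hh y hy
    simp only [linBracket_form]
    exact hπ.jacobi T hT subset_rfl f g h hf.contMDiffOn hg.contMDiffOn hh.contMDiffOn y hy

theorem linBracket_form_prod (π : Bivector (𝓘(𝕜, E).prod 𝓘(𝕜, E')) (E × E'))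
    (f g : E × E' → 𝕜) :
    linBracket (fun y => π.form y) f g = π.bracket f g := by
  have hd : ∀ (f : E × E' → 𝕜) (y : E × E'),
      dAt (𝓘(𝕜, E).prod 𝓘(𝕜, E')) f y = linDiff f y := by
    intro f y
    have h : (mfderiv (𝓘(𝕜, E).prod 𝓘(𝕜, E')) 𝓘(𝕜, 𝕜) f y : E × E' →L[𝕜] 𝕜)
        = fderiv 𝕜 f y := by
      rw [← mfderiv_eq_fderiv, ← modelWithCornersSelf_prod, ← chartedSpaceSelf_prod]
    unfold dAt linDiff
    rw [h]
  funext y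
  simp only [linBracket, bracket, hd]
  rfl

theorem contMDiffOn_prod_iff_contDiffOn {f : E × E' → 𝕜} {U : Set (E × E')} :
    ContMDiffOn (𝓘(𝕜, E).prod 𝓘(𝕜, E')) 𝓘(𝕜, 𝕜) ∞ f U ↔ ContDiffOn 𝕜 ∞ f U := by
  rw [← contMDiffOn_iff_contDiffOn, ← modelWithCornersSelf_prod, ← chartedSpaceSelf_prod]

theorem isPoissonOn_of_hasVanishingSchouten [FiniteDimensional 𝕜 E] [FiniteDimensional 𝕜 E']
    {π : Bivector (𝓘(𝕜, E).prod 𝓘(𝕜, E')) (E × E')} {T : Set (E × E')} (hT : IsOpen T)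
    (hπ : HasVanishingSchouten (fun y => π.form y) T) : π.IsPoissonOn T where
  smooth U hU hUT f g hf hg := by
    rw [contMDiffOn_prod_iff_contDiffOn] at hf hg ⊢
    rw [← linBracket_form_prod]
    exact hπ.contDiffOn_linBracket hU hUT hf hg
  jacobi U hU hUT f g h hf hg hh y hy := by
    rw [contMDiffOn_prod_iff_contDiffOn] at hf hg hh
    simp only [← linBracket_form_prod]
    have hn := hU.mem_nhds hy
    exact hπ.jacobi hT (fun y α => π.alt y α) (hUT hy) (hf.contDiffAt hn) (hg.contDiffAt hn)
      (hh.contDiffAt hn)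

/-- The direct sum of two Poisson tensors is a Poisson tensor. -/
theorem IsPoisson.prod [FiniteDimensional 𝕜 E] [FiniteDimensional 𝕜 E']
    {M : Type*} [TopologicalSpace M] [ChartedSpace E M] [IsManifold 𝓘(𝕜, E) ∞ M]
    {N : Type*} [TopologicalSpace N] [ChartedSpace E' N] [IsManifold 𝓘(𝕜, E') ∞ N]
    {π : Bivector 𝓘(𝕜, E) M} {ρ : Bivector 𝓘(𝕜, E') N} (hπ : π.IsPoisson) (hρ : ρ.IsPoisson) :
    (π.prod ρ).IsPoisson := by
  refine IsPoisson.of_local fun p => ?_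
  have hΦ := isLocalPoissonEquiv_pushAlong (I' := 𝓘(𝕜, E)) π (chartAt E p.1) contMDiffOn_chart
    contMDiffOn_chart_symm
  have hΨ := isLocalPoissonEquiv_pushAlong (I' := 𝓘(𝕜, E')) ρ (chartAt E' p.2) contMDiffOn_chart
    contMDiffOn_chart_symm
  have hS := ((hΦ.isPoissonOn (hπ.isPoissonOn _)).hasVanishingSchouten
    (chartAt E p.1).open_target).prod (chartAt E p.1).open_target
    ((hΨ.isPoissonOn (hρ.isPoissonOn _)).hasVanishingSchouten (chartAt E' p.2).open_target)
    (chartAt E' p.2).open_target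
  have hP := isPoissonOn_of_hasVanishingSchouten
    (π := (π.pushAlong (I' := 𝓘(𝕜, E)) (chartAt E p.1) (chartAt E p.1).symm).prod
      (ρ.pushAlong (I' := 𝓘(𝕜, E')) (chartAt E' p.2) (chartAt E' p.2).symm))
    ((chartAt E p.1).open_target.prod (chartAt E' p.2).open_target) hS
  exact ⟨_, ((chartAt E p.1).prod (chartAt E' p.2)).open_source,
    ⟨mem_chart_source E p.1, mem_chart_source E' p.2⟩, (hΦ.prod hΨ).symm.isPoissonOn hP⟩

end Bivector

end Product

/-! ### Poisson actions, momentum maps and the semidirect bracket -/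

noncomputable section Semidirect

variable {𝕜 : Type*} [RCLike 𝕜]
  {EG : Type*} [NormedAddCommGroup EG] [NormedSpace 𝕜 EG]
  {HG : Type*} [TopologicalSpace HG] {IG : ModelWithCorners 𝕜 EG HG}
  {G : Type*} [TopologicalSpace G] [ChartedSpace HG G] [Group G]
  {ES : Type*} [NormedAddCommGroup ES] [NormedSpace 𝕜 ES]
  {HS : Type*} [TopologicalSpace HS] {IS : ModelWithCorners 𝕜 ES HS}
  {S : Type*} [TopologicalSpace S] [ChartedSpace HS S] [Group S]
  {ED : Type*} [NormedAddCommGroup ED] [NormedSpace 𝕜 ED]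
  {HD : Type*} [TopologicalSpace HD] {ID : ModelWithCorners 𝕜 ED HD}
  {D : Type*} [TopologicalSpace D] [ChartedSpace HD D] [Group D]
  {EM : Type*} [NormedAddCommGroup EM] [NormedSpace 𝕜 EM]
  {HM : Type*} [TopologicalSpace HM] {IM : ModelWithCorners 𝕜 EM HM}
  {M : Type*} [TopologicalSpace M] [ChartedSpace HM M]
  {EN : Type*} [NormedAddCommGroup EN] [NormedSpace 𝕜 EN]
  {HN : Type*} [TopologicalSpace HN] {IN : ModelWithCorners 𝕜 EN HN}
  {N : Type*} [TopologicalSpace N] [ChartedSpace HN N]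

theorem Bivector.IsPoissonMap.bracket_eq {π : Bivector IM M} {π' : Bivector IN N} {φ : M → N}
    (hφ : π.IsPoissonMap π' φ) {x : M} {f h : N → 𝕜} (hf : MDifferentiableAt IN 𝓘(𝕜, 𝕜) f (φ x))
    (hh : MDifferentiableAt IN 𝓘(𝕜, 𝕜) h (φ x)) :
    π'.bracket f h (φ x) = π.bracket (fun z => f (φ z)) (fun z => h (φ z)) x := by
  have hd : MDifferentiableAt IM IN φ x := hφ.contMDiff.mdifferentiableAt (by simp)
  simp only [bracket, dAt_comp rfl hf hd, dAt_comp rfl hh hd]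
  exact hφ.form_eq x _ _

theorem IsPoissonAction.contMDiff_smul_const [MulAction D N] {πD : Bivector ID D}
    {πN : Bivector IN N} (hN : IsPoissonAction πD πN) (n : N) :
    ContMDiff ID IN ∞ (fun k : D => k • n) :=
  hN.contMDiff.comp (contMDiff_id.prodMk contMDiff_const)

theorem IsPoissonAction.contMDiff_const_smul [MulAction D N] {πD : Bivector ID D}
    {πN : Bivector IN N} (hN : IsPoissonAction πD πN) (k : D) :
    ContMDiff IN IN ∞ (fun n : N => k • n) :=
  hN.contMDiff.comp (contMDiff_const.prodMk contMDiff_id)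

/-- For a Poisson action, the bracket at `k • n` splits into a contribution of the group and one
of the space. -/
theorem IsPoissonAction.bracket_smul [MulAction D N] {πD : Bivector ID D} {πN : Bivector IN N}
    (hN : IsPoissonAction πD πN) {k : D} {n : N} {φ ψ : N → 𝕜}
    (hφ : MDifferentiableAt IN 𝓘(𝕜, 𝕜) φ (k • n)) (hψ : MDifferentiableAt IN 𝓘(𝕜, 𝕜) ψ (k • n)) :
    πN.bracket φ ψ (k • n)
      = πD.bracket (fun l => φ (l • n)) (fun l => ψ (l • n)) k
        + πN.bracket (fun z => φ (k • z)) (fun z => ψ (k • z)) n := by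
  have hd : MDifferentiableAt (ID.prod IN) IN (fun p : D × N => p.1 • p.2) (k, n) :=
    hN.contMDiff.mdifferentiableAt (by simp)
  exact (Bivector.IsPoissonMap.bracket_eq hN (x := (k, n)) hφ hψ).trans
    (Bivector.prod_bracket πD πN (MDifferentiableAt.comp (k, n) hφ hd)
      (MDifferentiableAt.comp (k, n) hψ hd))

namespace DrinfeldDouble

variable (Δ : DrinfeldDouble IG G IS S ID D)

theorem actD_apply [MulAction D M] {πD : Bivector ID D} {πM : Bivector IM M}
    (hM : IsPoissonAction πD πM) {f : M → 𝕜} {m : M} (hf : MDifferentiableAt IM 𝓘(𝕜, 𝕜) f m)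
    (X : GroupLieAlgebra IG G) : Δ.actD f m X = dAt IM f m (Δ.infAction IM X m) := by
  have hd : MDifferentiableAt IG IM (fun g : G => Δ.incl g • m) (1 : G) :=
    ((hM.contMDiff_smul_const m).comp Δ.contMDiff_incl).mdifferentiableAt (by simp)
  exact DFunLike.congr_fun
    (dAt_comp (φ := fun g : G => Δ.incl g • m) (x := (1 : G)) (by simp) hf hd) X

theorem mdifferentiableAt_dualIncl_smul [MulAction D N] {πD : Bivector ID D} {πN : Bivector IN N}
    (hN : IsPoissonAction πD πN) {φ : N → 𝕜} {p : S} {n : N}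
    (hφ : MDifferentiableAt IN 𝓘(𝕜, 𝕜) φ (Δ.dualIncl p • n)) :
    MDifferentiableAt IS 𝓘(𝕜, 𝕜) (fun q : S => φ (Δ.dualIncl q • n)) p :=
  MDifferentiableAt.comp (f := fun q : S => Δ.dualIncl q • n) p hφ
    (((hN.contMDiff_smul_const n).comp Δ.contMDiff_dualIncl).mdifferentiableAt (by simp))

/-- The right-invariant one-form defined by `∇φ` at `p n` is the differential at `p` of
`q ↦ φ(q n)`: right translation to the identity turns this function into `q ↦ φ(q (p n))`. -/
theorem rightInvForm_actNabla [FiniteDimensional 𝕜 EG] [ContMDiffMul IS ∞ S] [MulAction D N]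
    {πD : Bivector ID D} {πN : Bivector IN N} (hN : IsPoissonAction πD πN) {φ : N → 𝕜} {p : S}
    {n : N} (hφ : MDifferentiableAt IN 𝓘(𝕜, 𝕜) φ (Δ.dualIncl p • n)) :
    Δ.rightInvForm (Δ.actNabla φ (Δ.dualIncl p • n)) p
      = dAt IS (fun q : S => φ (Δ.dualIncl q • n)) p := by
  have hd : MDifferentiableAt IS IS (fun q : S => q * p⁻¹) p :=
    (contMDiff_mul_right (n := ∞)).mdifferentiableAt (by simp)
  have h := dAt_comp (y := (1 : S)) (by simp)
    (Δ.mdifferentiableAt_dualIncl_smul hN (p := 1) (n := Δ.dualIncl p • n) (by simpa using hφ)) hd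
  have hfun : (fun q : S => φ (Δ.dualIncl (q * p⁻¹) • Δ.dualIncl p • n))
      = fun q : S => φ (Δ.dualIncl q • n) := by
    funext q
    rw [smul_smul, ← map_mul, inv_mul_cancel_right]
  rw [hfun] at h
  rw [h]
  refine LinearMap.ext fun v => ?_
  refine (Module.apply_evalEquiv_symm_apply 𝕜 (GroupLieAlgebra IG G) _ _).trans ?_
  simp only [LinearMap.comp_apply, LinearEquiv.coe_coe]
  erw [LinearEquiv.symm_apply_apply]
  rfl

/-- For a momentum map `J`, the bracket of `f` with `m' ↦ ψ(J(m') n)` is the derivative of `f`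
along the `𝔤`-action in the direction `∇ψ`. -/
theorem bracket_momentum [FiniteDimensional 𝕜 EG] [ContMDiffMul IS ∞ S] [MulAction D M]
    [MulAction D N] {πD : Bivector ID D} {πM : Bivector IM M} {πN : Bivector IN N}
    (hM : IsPoissonAction πD πM) (hN : IsPoissonAction πD πN) {J : M → S}
    (hJ : Δ.IsMomentumMap πM J) {f : M → 𝕜} {ψ : N → 𝕜} {m : M} {n : N}
    (hf : MDifferentiableAt IM 𝓘(𝕜, 𝕜) f m)
    (hψ : MDifferentiableAt IN 𝓘(𝕜, 𝕜) ψ (Δ.dualIncl (J m) • n)) :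
    πM.bracket f (fun z => ψ (Δ.dualIncl (J z) • n)) m
      = Δ.actD f m (Δ.actNabla ψ (Δ.dualIncl (J m) • n)) := by
  have hd : MDifferentiableAt IM IS J m := hJ.contMDiff.mdifferentiableAt (by simp)
  rw [Δ.actD_apply hM hf, ← hJ.momentum, Δ.rightInvForm_actNabla hN hψ, Bivector.bracket,
    dAt_comp rfl (Δ.mdifferentiableAt_dualIncl_smul hN hψ) hd]
  rfl

/-- The bracket of functions `f(m) + φ(n)` and `h(m) + ψ(n)` at the point `(m, J(m) n)`. -/
theorem semidirect_bracket [FiniteDimensional 𝕜 EG] [ContMDiffMul IS ∞ S] [MulAction D M]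
    [MulAction D N] {πD : Bivector ID D} {πS : Bivector IS S} {πM : Bivector IM M}
    {πN : Bivector IN N} (hS : πS.IsPoissonMap πD Δ.dualIncl)
    (hM : IsPoissonAction πD πM) (hN : IsPoissonAction πD πN) {J : M → S}
    (hJ : Δ.IsMomentumMap πM J) (hJP : πM.IsPoissonMap πS J)
    (hσ : ContMDiff (IM.prod IN) (IM.prod IN) ∞ (Δ.semidirectEquiv (N := N) J))
    {f h : M → 𝕜} {φ ψ : N → 𝕜} {m : M} {n : N}
    (hf : MDifferentiableAt IM 𝓘(𝕜, 𝕜) f m) (hh : MDifferentiableAt IM 𝓘(𝕜, 𝕜) h m)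
    (hφ : MDifferentiableAt IN 𝓘(𝕜, 𝕜) φ (Δ.dualIncl (J m) • n))
    (hψ : MDifferentiableAt IN 𝓘(𝕜, 𝕜) ψ (Δ.dualIncl (J m) • n)) :
    (Δ.semidirect J πM πN).bracket (fun p : M × N => f p.1 + φ p.2)
        (fun p : M × N => h p.1 + ψ p.2) (m, Δ.dualIncl (J m) • n)
      = πM.bracket f h m + πN.bracket φ ψ (Δ.dualIncl (J m) • n)
        + Δ.actD f m (Δ.actNabla ψ (Δ.dualIncl (J m) • n))
        - Δ.actD h m (Δ.actNabla φ (Δ.dualIncl (J m) • n)) := by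
  have hsum : ∀ {f : M → 𝕜} {φ : N → 𝕜}, MDifferentiableAt IM 𝓘(𝕜, 𝕜) f m →
      MDifferentiableAt IN 𝓘(𝕜, 𝕜) φ (Δ.dualIncl (J m) • n) →
      MDifferentiableAt (IM.prod IN) 𝓘(𝕜, 𝕜) (fun p : M × N => f p.1 + φ p.2)
        (m, Δ.dualIncl (J m) • n) := fun hf hφ =>
    MDifferentiableAt.add
      (MDifferentiableAt.comp (f := Prod.fst) (m, Δ.dualIncl (J m) • n) hf mdifferentiableAt_fst)
      (MDifferentiableAt.comp (f := Prod.snd) (m, Δ.dualIncl (J m) • n) hφ mdifferentiableAt_snd)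
  have hsymm : (Δ.semidirectEquiv J).symm (m, Δ.dualIncl (J m) • n) = (m, n) :=
    (Δ.semidirectEquiv J).left_inv (m, n)
  have hσd : MDifferentiableAt (IM.prod IN) (IM.prod IN) (Δ.semidirectEquiv (N := N) J) (m, n) :=
    hσ.mdifferentiableAt (by simp)
  -- Transport by `Σ` reduces the bracket to a direct sum bracket at `(m, n)`.
  have h1 : (Δ.semidirect J πM πN).bracket (fun p : M × N => f p.1 + φ p.2)
        (fun p : M × N => h p.1 + ψ p.2) (m, Δ.dualIncl (J m) • n)
      = (πM.prod πN).bracket (fun p : M × N => f p.1 + φ (Δ.dualIncl (J p.1) • p.2))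
        (fun p : M × N => h p.1 + ψ (Δ.dualIncl (J p.1) • p.2)) (m, n) := by
    have := Bivector.pushAlong_bracket (πM.prod πN) (φ := Δ.semidirectEquiv J)
      (ψ := (Δ.semidirectEquiv J).symm) (y := (m, Δ.dualIncl (J m) • n)) (by simp)
      (by rw [hsymm]; exact hσd) (hsum hf hφ) (hsum hh hψ)
    rw [hsymm] at this
    exact this
  have h2 : (πM.prod πN).bracket (fun p : M × N => f p.1 + φ (Δ.dualIncl (J p.1) • p.2))
        (fun p : M × N => h p.1 + ψ (Δ.dualIncl (J p.1) • p.2)) (m, n)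
      = πM.bracket (fun z => f z + φ (Δ.dualIncl (J z) • n))
          (fun z => h z + ψ (Δ.dualIncl (J z) • n)) m
        + πN.bracket (fun z => f m + φ (Δ.dualIncl (J m) • z))
          (fun z => h m + ψ (Δ.dualIncl (J m) • z)) n := Bivector.prod_bracket πM πN
    (MDifferentiableAt.comp (m, n) (hsum hf hφ) hσd)
    (MDifferentiableAt.comp (m, n) (hsum hh hψ) hσd)
  have hs : MDifferentiableAt IN IN (fun z : N => Δ.dualIncl (J m) • z) n :=
    (hN.contMDiff_const_smul (Δ.dualIncl (J m))).mdifferentiableAt (by simp)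
  have hJd : MDifferentiableAt IM IS J m := hJ.contMDiff.mdifferentiableAt (by simp)
  have hpull : ∀ {φ : N → 𝕜}, MDifferentiableAt IN 𝓘(𝕜, 𝕜) φ (Δ.dualIncl (J m) • n) →
      MDifferentiableAt IM 𝓘(𝕜, 𝕜) (fun z => φ (Δ.dualIncl (J z) • n)) m := fun hφ =>
    MDifferentiableAt.comp (f := J) m (Δ.mdifferentiableAt_dualIncl_smul hN hφ) hJd
  have h3 : πN.bracket (fun z => f m + φ (Δ.dualIncl (J m) • z))
      (fun z => h m + ψ (Δ.dualIncl (J m) • z)) n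
      = πN.bracket (fun z => φ (Δ.dualIncl (J m) • z)) (fun z => ψ (Δ.dualIncl (J m) • z)) n := by
    simp only [Bivector.bracket]
    rw [dAt_const_add (f := fun z => φ (Δ.dualIncl (J m) • z)) (MDifferentiableAt.comp n hφ hs),
      dAt_const_add (f := fun z => ψ (Δ.dualIncl (J m) • z)) (MDifferentiableAt.comp n hψ hs)]
  have h4 : πM.bracket (fun z => f z + φ (Δ.dualIncl (J z) • n))
      (fun z => h z + ψ (Δ.dualIncl (J z) • n)) m
      = πM.bracket f h m + πM.bracket f (fun z => ψ (Δ.dualIncl (J z) • n)) m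
        - πM.bracket h (fun z => φ (Δ.dualIncl (J z) • n)) m
        + πM.bracket (fun z => φ (Δ.dualIncl (J z) • n)) (fun z => ψ (Δ.dualIncl (J z) • n)) m := by
    simp only [Bivector.bracket]
    rw [dAt_add hf (hpull hφ), dAt_add hh (hpull hψ), πM.form_swap m (dAt IM h m)]
    simp only [map_add, LinearMap.add_apply]
    ring
  -- The Poisson maps `M → G* → D` carry the bracket of the two pulled back functions to `D`,
  -- where it is the group contribution to the bracket at `J(m) n`.
  have h5 : πM.bracket (fun z => φ (Δ.dualIncl (J z) • n)) (fun z => ψ (Δ.dualIncl (J z) • n)) m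
      = πD.bracket (fun l => φ (l • n)) (fun l => ψ (l • n)) (Δ.dualIncl (J m)) := by
    have hl : ∀ {φ : N → 𝕜}, MDifferentiableAt IN 𝓘(𝕜, 𝕜) φ (Δ.dualIncl (J m) • n) →
        MDifferentiableAt ID 𝓘(𝕜, 𝕜) (fun l : D => φ (l • n)) (Δ.dualIncl (J m)) := fun hφ =>
      MDifferentiableAt.comp (f := fun l : D => l • n) (Δ.dualIncl (J m)) hφ
        ((hN.contMDiff_smul_const n).mdifferentiableAt (by simp))
    rw [hS.bracket_eq (hl hφ) (hl hψ)]
    exact (hJP.bracket_eq (Δ.mdifferentiableAt_dualIncl_smul hN hφ)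
      (Δ.mdifferentiableAt_dualIncl_smul hN hψ)).symm
  rw [h1, h2, h3, h4, h5, Δ.bracket_momentum hM hN hJ hf hψ, Δ.bracket_momentum hM hN hJ hh hφ,
    hN.bracket_smul hφ hψ]
  ring

theorem contMDiff_semidirectEquiv [MulAction D N] {πD : Bivector ID D} {πN : Bivector IN N}
    (hN : IsPoissonAction πD πN) {J : M → S} (hJ : ContMDiff IM IS ∞ J) :
    ContMDiff (IM.prod IN) (IM.prod IN) ∞ (Δ.semidirectEquiv (N := N) J) :=
  contMDiff_fst.prodMk (hN.contMDiff.comp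
    (((Δ.contMDiff_dualIncl.comp hJ).comp contMDiff_fst).prodMk contMDiff_snd))

theorem contMDiff_semidirectEquiv_symm [LieGroup ID ∞ D] [MulAction D N] {πD : Bivector ID D}
    {πN : Bivector IN N} (hN : IsPoissonAction πD πN) {J : M → S} (hJ : ContMDiff IM IS ∞ J) :
    ContMDiff (IM.prod IN) (IM.prod IN) ∞ (Δ.semidirectEquiv (N := N) J).symm :=
  contMDiff_fst.prodMk (hN.contMDiff.comp
    (((Δ.contMDiff_dualIncl.comp hJ).comp contMDiff_fst).inv.prodMk contMDiff_snd))

end DrinfeldDouble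

end Semidirect

end PoissonGeometry

open PoissonGeometry in
theorem proposition3p1 {𝕜 : Type*} [RCLike 𝕜]
    {EG : Type*} [NormedAddCommGroup EG] [NormedSpace 𝕜 EG] [FiniteDimensional 𝕜 EG]
    {ES : Type*} [NormedAddCommGroup ES] [NormedSpace 𝕜 ES] [FiniteDimensional 𝕜 ES]
    {ED : Type*} [NormedAddCommGroup ED] [NormedSpace 𝕜 ED] [FiniteDimensional 𝕜 ED]
    {EM : Type*} [NormedAddCommGroup EM] [NormedSpace 𝕜 EM] [FiniteDimensional 𝕜 EM]
    {EN : Type*} [NormedAddCommGroup EN] [NormedSpace 𝕜 EN] [FiniteDimensional 𝕜 EN]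
    -- the Poisson Lie group `G`, the dual group `S = G*` and the double `D`
    {G : Type*} [TopologicalSpace G] [ChartedSpace EG G] [Group G] [LieGroup 𝓘(𝕜, EG) ∞ G]
    {S : Type*} [TopologicalSpace S] [ChartedSpace ES S] [Group S] [LieGroup 𝓘(𝕜, ES) ∞ S]
    [ConnectedSpace S]
    {D : Type*} [TopologicalSpace D] [ChartedSpace ED D] [Group D] [LieGroup 𝓘(𝕜, ED) ∞ D]
    [ConnectedSpace D]
    (Δ : DrinfeldDouble 𝓘(𝕜, EG) G 𝓘(𝕜, ES) S 𝓘(𝕜, ED) D)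
    -- `D` has the Sklyanin bracket, with any normalization; `G` and `G*` are Poisson in `D`
    (c : 𝕜) (hc : c ≠ 0)
    (πG : Bivector 𝓘(𝕜, EG) G) (hπG : IsPoissonLie πG)
    (hG : πG.IsPoissonMap (Δ.sklyanin c) Δ.incl)
    (πS : Bivector 𝓘(𝕜, ES) S) (hS : πS.IsPoissonMap (Δ.sklyanin c) Δ.dualIncl)
    -- the Poisson spaces `M` and `N`, with Poisson actions of `D`
    {M : Type*} [TopologicalSpace M] [ChartedSpace EM M] [IsManifold 𝓘(𝕜, EM) ∞ M]
    {N : Type*} [TopologicalSpace N] [ChartedSpace EN N] [IsManifold 𝓘(𝕜, EN) ∞ N]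
    (πM : Bivector 𝓘(𝕜, EM) M) (hπM : πM.IsPoisson)
    (πN : Bivector 𝓘(𝕜, EN) N) (hπN : πN.IsPoisson)
    [MulAction D M] (hM : IsPoissonAction (Δ.sklyanin c) πM)
    [MulAction D N] (hN : IsPoissonAction (Δ.sklyanin c) πN)
    -- the momentum map of the action of `G` on `M`, which is a Poisson map
    (J : M → S) (hJ : Δ.IsMomentumMap πM J) (hJP : πM.IsPoissonMap πS J) :
    ContMDiff (𝓘(𝕜, EM).prod 𝓘(𝕜, EN)) (𝓘(𝕜, EM).prod 𝓘(𝕜, EN)) ∞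
        (Δ.semidirectEquiv (N := N) J) ∧
    ContMDiff (𝓘(𝕜, EM).prod 𝓘(𝕜, EN)) (𝓘(𝕜, EM).prod 𝓘(𝕜, EN)) ∞
        (Δ.semidirectEquiv (N := N) J).symm ∧
    (Δ.semidirect J πM πN).IsPoisson ∧
    ∀ (U : Set M) (V : Set N), IsOpen U → IsOpen V →
      ∀ f h : M → 𝕜, ContMDiffOn 𝓘(𝕜, EM) 𝓘(𝕜, 𝕜) ∞ f U → ContMDiffOn 𝓘(𝕜, EM) 𝓘(𝕜, 𝕜) ∞ h U →
      ∀ φ ψ : N → 𝕜, ContMDiffOn 𝓘(𝕜, EN) 𝓘(𝕜, 𝕜) ∞ φ V → ContMDiffOn 𝓘(𝕜, EN) 𝓘(𝕜, 𝕜) ∞ ψ V →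
      ∀ m ∈ U, ∀ n ∈ V,
        (Δ.semidirect J πM πN).bracket
            (fun p : M × N => f p.1 + φ p.2) (fun p : M × N => h p.1 + ψ p.2) (m, n)
          = πM.bracket f h m + πN.bracket φ ψ n
            + Δ.actD f m (Δ.actNabla ψ n) - Δ.actD h m (Δ.actNabla φ n) := by
  have hσ := Δ.contMDiff_semidirectEquiv hN hJ.contMDiff
  have hσ' := Δ.contMDiff_semidirectEquiv_symm hN hJ.contMDiff
  refine ⟨hσ, hσ', (hπM.prod hπN).pushforward _ hσ hσ', ?_⟩
  intro U V hU hV f h hf hh φ ψ hφ hψ m hm n hn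
  obtain ⟨n, rfl⟩ : ∃ n₀ : N, Δ.dualIncl (J m) • n₀ = n := ⟨(Δ.dualIncl (J m))⁻¹ • n, by simp⟩
  exact Δ.semidirect_bracket hS hM hN hJ hJP hσ
    (Bivector.mdifferentiableAt_of_contMDiffOn hU hf hm)
    (Bivector.mdifferentiableAt_of_contMDiffOn hU hh hm)
    (Bivector.mdifferentiableAt_of_contMDiffOn hV hφ hn)
    (Bivector.mdifferentiableAt_of_contMDiffOn hV hψ hn)
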